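/- Let $d\ge 1$ and let $(X_k)_{k\ge 0}$ be i.i.d. random vectors with values in $\mathbb{Z}^d$, with $Z_n = X_0+\dots+X_{n-1}$ ($Z_0=0$) the associated random walk, and let $\Sigma=\{\ell\in\mathbb{Z}^d:\mathbb{P}(X_0=\ell)>0\}$. Assume the walk is reduced: the subgroup $L$ of $\mathbb{Z}^d$ generated by $\Sigma$ has finite index. Let $D$ be the subgroup of $\mathbb{Z}^d$ generated by $\{\ell-\ell' : \ell,\ell'\in\Sigma\}$, let $d_0$ be the dimension of the real vector space spanned by $D$, let $\Gamma_1=\{t\in\mathbb{T}^d : e^{2\pi i\langle r,t\rangle}=1\ \ \forall r\in D\}$ be the annihilator of $D$, and let $d\gamma_1$ be the Haar probability measure of $\Gamma_1$, viewed as a measure on $\mathbb{T}^d$. Put $R_n(\ell)=\mathbb{P}(Z_n=\ell)$ and $$\tilde R_n(t)=\frac{\bigl|\sum_{\ell\in\mathbb{Z}^d}R_n(\ell)\,e^{2\pi i\langle \ell,t\rangle}\bigr|^2}{\sum_{\ell\in\mathbb{Z}^d}R_n(\ell)^2},\qquad t\in\mathbb{T}^d .$$ Then: 1. $(\tilde R_n)$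 converges weakly to $d\gamma_1$: $\int_{\mathbb{T}^d}\tilde R_n\,\varphi\,dt\to\int_{\mathbb{T}^d}\varphi\,d\gamma_1$ as $n\to\infty$ for every continuous $\varphi:\mathbb{T}^d\to\mathbb{R}$. 2. $d_0=d-\delta$ with $\delta\in\{0,1\}$, and, if moreover $\mathbb{E}|X_0|^2<\infty$, the normalization is of order $n^{-d_0/2}$: there is a constant $C>0$, depending on the walk, such that $\sum_{\ell}R_n(\ell)^2\sim C\,n^{-d_0/2}$ as $n\to\infty$. -/

import Mathlib

open MeasureTheory ProbabilityTheory Filter Topology Asymptotics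

noncomputable section

namespace BarycenterSummation

/-- The position at time `n` of the random walk with steps `X 0, X 1, …`, started from `0`. -/
def walk {d : ℕ} {Ω : Type*} (X : ℕ → Ω → (Fin d → ℤ)) (n : ℕ) (ω : Ω) : Fin d → ℤ :=
  ∑ k ∈ Finset.range n, X k ω

/-- The barycenter summation `R_n(ℓ) = ℙ(Z_n = ℓ)`. -/
def baryc {d : ℕ} {Ω : Type*} [MeasurableSpace Ω] (P : Measure Ω) (X : ℕ → Ω → (Fin d → ℤ))
    (n : ℕ) (l : Fin d → ℤ) : ℝ :=
  P.real {ω | walk X n ω = l}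

/-- The support of the law of a random vector `Y` of `ℤ^d`: its atoms. -/
def lawSupport {d : ℕ} {Ω : Type*} [MeasurableSpace Ω] (P : Measure Ω) (Y : Ω → (Fin d → ℤ)) :
    Set (Fin d → ℤ) :=
  {l | P {ω | Y ω = l} ≠ 0}

/-- The lattice `L` generated by a set of integer vectors. -/
def latticeL {d : ℕ} (S : Set (Fin d → ℤ)) : AddSubgroup (Fin d → ℤ) :=
  AddSubgroup.closure S

/-- The lattice `D` generated by the differences of elements of a set of integer vectors. -/
def latticeD {d : ℕ} (S : Set (Fin d → ℤ)) : AddSubgroup (Fin d → ℤ) :=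
  AddSubgroup.closure {v | ∃ l ∈ S, ∃ l' ∈ S, v = l - l'}

/-- The dimension of the real vector space spanned by a lattice of `ℤ^d`. -/
def latticeDim {d : ℕ} (D : AddSubgroup (Fin d → ℤ)) : ℕ :=
  Module.finrank ℝ
    (Submodule.span ℝ ((fun (l : Fin d → ℤ) (i : Fin d) => (l i : ℝ)) '' (D : Set (Fin d → ℤ))))

/-- The uniform (Lebesgue) probability measure `dt` on the torus `𝕋^d`. -/
def torusMeasure (d : ℕ) : Measure (UnitAddTorus (Fin d)) :=
  Measure.pi fun _ => AddCircle.haarAddCircle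

/-- The annihilator in `𝕋^d` of a lattice of `ℤ^d`. Here `UnitAddTorus.mFourier r t` is
`e^{2πi⟨r, t⟩}`. -/
def annihilator {d : ℕ} (D : AddSubgroup (Fin d → ℤ)) : AddSubgroup (UnitAddTorus (Fin d)) where
  carrier := {t | ∀ r ∈ D, UnitAddTorus.mFourier r t = 1}
  zero_mem' := by
    intro r _
    simp [UnitAddTorus.mFourier]
  add_mem' := by
    intro s t hs ht r hr
    have h1 := hs r hr
    have h2 := ht r hr
    simp only [UnitAddTorus.mFourier, ContinuousMap.coe_mk, fourier_apply] at h1 h2 ⊢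
    simp only [Pi.add_apply, smul_add, AddCircle.toCircle_add, Circle.coe_mul,
      Finset.prod_mul_distrib, h1, h2, mul_one]
  neg_mem' := by
    intro t ht r hr
    have h := ht (-r) (D.neg_mem hr)
    simp only [UnitAddTorus.mFourier, ContinuousMap.coe_mk, fourier_apply] at h ⊢
    simpa only [Pi.neg_apply, neg_smul, smul_neg] using h

theorem isClosed_annihilator {d : ℕ} (D : AddSubgroup (Fin d → ℤ)) :
    IsClosed (annihilator D : Set (UnitAddTorus (Fin d))) := by
  have h : (annihilator D : Set (UnitAddTorus (Fin d))) =
      ⋂ r ∈ D, {t | UnitAddTorus.mFourier r t = 1} := by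
    ext t
    simp [annihilator]
  rw [h]
  exact isClosed_biInter fun r _ =>
    isClosed_eq (UnitAddTorus.mFourier r).continuous continuous_const

instance compactSpace_annihilator {d : ℕ} (D : AddSubgroup (Fin d → ℤ)) :
    CompactSpace (annihilator D) :=
  isCompact_iff_compactSpace.mp (isClosed_annihilator D).isCompact

/-- The Haar probability measure of the annihilator of `D`, as a measure on `𝕋^d`. -/
def annihilatorHaar {d : ℕ} (D : AddSubgroup (Fin d → ℤ)) : Measure (UnitAddTorus (Fin d)) :=
  (Measure.addHaarMeasure (⊤ : TopologicalSpace.PositiveCompacts (annihilator D))).map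
    Subtype.val

/-- The normalized nonnegative kernel on `𝕋^d` of a summable function `R` on `ℤ^d`. -/
def normKernel {d : ℕ} (R : (Fin d → ℤ) → ℝ) (t : UnitAddTorus (Fin d)) : ℝ :=
  ‖∑' l, (R l : ℂ) * UnitAddTorus.mFourier l t‖ ^ 2 / ∑' l, R l ^ 2

/-- The sequence `R` is `ζ`-regular: its normalized kernels converge weakly to the probability
measure `ζ` on `𝕋^d`. -/
def IsRegular {d : ℕ} (R : ℕ → (Fin d → ℤ) → ℝ) (ζ : Measure (UnitAddTorus (Fin d))) : Prop :=
  IsProbabilityMeasure ζ ∧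
    ∀ φ : C(UnitAddTorus (Fin d), ℝ),
      Tendsto (fun n : ℕ => ∫ t, normKernel (R n) t * φ t ∂torusMeasure d) atTop
        (𝓝 (∫ t, φ t ∂ζ))

end BarycenterSummation

end

noncomputable section

namespace BarycenterSummation

open UnitAddTorus

theorem norm_mFourier_apply {d : ℕ} (l : Fin d → ℤ) (t : UnitAddTorus (Fin d)) :
    ‖mFourier l t‖ = 1 := by
  simp only [mFourier, fourier_apply, ContinuousMap.coe_mk, norm_prod, Circle.norm_coe,
    Finset.prod_const_one]

theorem mFourier_apply_add {d : ℕ} (l : Fin d → ℤ) (s t : UnitAddTorus (Fin d)) :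
    mFourier l (s + t) = mFourier l s * mFourier l t := by
  simp only [mFourier, ContinuousMap.coe_mk, fourier_apply, Pi.add_apply, smul_add,
    AddCircle.toCircle_add, Circle.coe_mul, Finset.prod_mul_distrib]

theorem mFourier_apply_zero {d : ℕ} (l : Fin d → ℤ) :
    mFourier l (0 : UnitAddTorus (Fin d)) = 1 := by
  simp [mFourier]

theorem mFourier_sub {d : ℕ} (l l' : Fin d → ℤ) (t : UnitAddTorus (Fin d)) :
    mFourier (l - l') t = mFourier l t * (starRingEnd ℂ) (mFourier l' t) := by
  rw [sub_eq_add_neg, mFourier_add, mFourier_neg]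

theorem norm_one_sub_sq_of_norm_eq_one {z : ℂ} (hz : ‖z‖ = 1) :
    ‖1 - z‖ ^ 2 = 2 * (1 - z.re) := by
  have h : Complex.normSq z = 1 := by rw [Complex.normSq_eq_norm_sq, hz, one_pow]
  rw [Complex.normSq_apply] at h
  rw [← Complex.normSq_eq_norm_sq, Complex.normSq_apply]
  simp only [Complex.sub_re, Complex.one_re, Complex.sub_im, Complex.one_im]
  linear_combination h

/-- The characteristic function, on the torus, of a measure on `ℤ^d`. -/
def charSum {d : ℕ} (ν : Measure (Fin d → ℤ)) (t : UnitAddTorus (Fin d)) : ℂ :=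
  ∫ x, mFourier x t ∂ν

instance isProbabilityMeasure_torusMeasure (d : ℕ) : IsProbabilityMeasure (torusMeasure d) := by
  unfold torusMeasure; infer_instance

instance isAddHaarMeasure_torusMeasure (d : ℕ) : (torusMeasure d).IsAddHaarMeasure := by
  unfold torusMeasure; infer_instance

section charSum

variable {d : ℕ} (ν : Measure (Fin d → ℤ)) [IsProbabilityMeasure ν]

theorem integrable_mFourier (t : UnitAddTorus (Fin d)) : Integrable (fun x => mFourier x t) ν :=
  Integrable.of_bound (measurable_of_countable _).aestronglyMeasurable 1
    (ae_of_all _ fun x => (norm_mFourier_apply x t).le)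

theorem continuous_charSum : Continuous (charSum ν) :=
  continuous_of_dominated (bound := fun _ => 1)
    (fun t => (integrable_mFourier ν t).aestronglyMeasurable)
    (fun t => ae_of_all _ fun x => (norm_mFourier_apply x t).le) (integrable_const _)
    (ae_of_all _ fun x => (mFourier x).continuous)

theorem charSum_zero : charSum ν 0 = 1 := by
  simp [charSum, mFourier_apply_zero]

theorem norm_charSum_le_one (t : UnitAddTorus (Fin d)) : ‖charSum ν t‖ ≤ 1 := by
  simpa [charSum] using norm_integral_le_of_norm_le_const (μ := ν) (C := 1)
    (ae_of_all _ fun x => (norm_mFourier_apply x t).le)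

theorem normSq_charSum_le_one (t : UnitAddTorus (Fin d)) : ‖charSum ν t‖ ^ 2 ≤ 1 :=
  pow_le_one₀ (norm_nonneg _) (norm_charSum_le_one ν t)

theorem charSum_eq_tsum (t : UnitAddTorus (Fin d)) :
    charSum ν t = ∑' l, (ν.real {l} : ℂ) * mFourier l t := by
  rw [charSum, integral_countable (integrable_mFourier ν t)]
  simp

theorem integral_mFourier (l : Fin d → ℤ) :
    ∫ t, mFourier l t ∂torusMeasure d = if l = 0 then 1 else 0 := by
  have h := orthonormal_iff_ite.mp (orthonormal_mFourier (d := Fin d)) 0 l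
  rw [ContinuousMap.inner_toLp] at h
  simp only [mFourier_zero, ContinuousMap.one_apply, map_one, mul_one] at h
  refine Eq.trans h ?_
  simp only [eq_comm]

theorem mFourierCoeff_charSum (l : Fin d → ℤ) :
    ∫ t, mFourier (-l) t * charSum ν t ∂torusMeasure d = ν.real {l} := by
  have h1 : ∀ t, mFourier (-l) t * charSum ν t = ∫ x, mFourier (x - l) t ∂ν := fun t => by
    rw [charSum, ← integral_const_mul]
    refine integral_congr_ae (ae_of_all _ fun x => ?_)
    simp only
    rw [sub_eq_neg_add, mFourier_add]
  simp_rw [h1]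
  rw [integral_integral_swap]
  · simp_rw [integral_mFourier, sub_eq_zero]
    have : (fun x => if x = l then (1 : ℂ) else 0) = Set.indicator {l} (fun _ => 1) := by
      ext x; simp [Set.indicator_apply]
    rw [this, integral_indicator (measurableSet_singleton l)]
    simp [Measure.real]
  · refine Integrable.of_bound (C := 1) ?_ (ae_of_all _ fun z => (norm_mFourier_apply _ _).le)
    refine Measurable.aestronglyMeasurable ?_
    exact measurable_from_prod_countable_left fun x => (mFourier (x - l)).continuous.measurable

theorem hasSum_sq_charSum :
    HasSum (fun l => ν.real {l} ^ 2) (∫ t, ‖charSum ν t‖ ^ 2 ∂torusMeasure d) := by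
  let f : C(UnitAddTorus (Fin d), ℂ) := ⟨charSum ν, continuous_charSum ν⟩
  have h := hasSum_sq_mFourierCoeff (ContinuousMap.toLp 2 (torusMeasure d) ℂ f)
  have h1 : ∀ l, mFourierCoeff (ContinuousMap.toLp 2 (torusMeasure d) ℂ f) l = ν.real {l} :=
    fun l => (mFourierCoeff_toLp f l).trans (mFourierCoeff_charSum ν l)
  have h2 : ∫ t, ‖(ContinuousMap.toLp 2 (torusMeasure d) ℂ f) t‖ ^ 2 ∂torusMeasure d =
      ∫ t, ‖charSum ν t‖ ^ 2 ∂torusMeasure d := by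
    refine integral_congr_ae ?_
    filter_upwards [ContinuousMap.coeFn_toLp (p := 2) (𝕜 := ℂ) (torusMeasure d) f] with t ht
    rw [ht]; rfl
  rw [← h2]
  refine HasSum.congr_fun h fun l => ?_
  refine ((congrArg (fun z : ℂ => ‖z‖ ^ 2) (h1 l)).trans ?_).symm
  simp only [Complex.norm_real, Real.norm_eq_abs, sq_abs]

theorem normSq_charSum (t : UnitAddTorus (Fin d)) :
    ‖charSum ν t‖ ^ 2 = ∫ z : (Fin d → ℤ) × (Fin d → ℤ), (mFourier (z.1 - z.2) t).re
      ∂(ν.prod ν) := by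
  have h : ((‖charSum ν t‖ ^ 2 : ℝ) : ℂ) =
      ∫ z : (Fin d → ℤ) × (Fin d → ℤ), mFourier (z.1 - z.2) t ∂(ν.prod ν) := by
    simp_rw [mFourier_sub]
    rw [integral_prod_mul (fun x => mFourier x t) (fun x => (starRingEnd ℂ) (mFourier x t)),
      integral_conj]
    rw [← charSum, Complex.mul_conj, Complex.normSq_eq_norm_sq]
  have h2 := congrArg Complex.re h
  rw [Complex.ofReal_re] at h2
  rw [h2]
  refine (integral_re (𝕜 := ℂ) ?_).symm
  exact Integrable.of_bound (measurable_of_countable _).aestronglyMeasurable 1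
    (ae_of_all _ fun _ => (norm_mFourier_apply _ t).le)

theorem integrable_re_mFourier_sub (t : UnitAddTorus (Fin d)) :
    Integrable (fun z : (Fin d → ℤ) × (Fin d → ℤ) => (mFourier (z.1 - z.2) t).re)
      (ν.prod ν) :=
  Integrable.of_bound (measurable_of_countable _).aestronglyMeasurable 1
    (ae_of_all _ fun _ => (Complex.abs_re_le_norm _).trans (norm_mFourier_apply _ t).le)

theorem one_sub_normSq_charSum (t : UnitAddTorus (Fin d)) :
    1 - ‖charSum ν t‖ ^ 2 = ∫ z : (Fin d → ℤ) × (Fin d → ℤ), (1 - (mFourier (z.1 - z.2) t).re)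
      ∂(ν.prod ν) := by
  rw [integral_sub (integrable_const _) (integrable_re_mFourier_sub ν t), normSq_charSum]
  simp

/-- On the lattice generated by the differences of atoms, `1 - e_r` is controlled by the defect
`1 - |φ|²`. -/
theorem exists_norm_one_sub_mFourier_sq_le {r : Fin d → ℤ} (hr : r ∈ latticeD {l | ν {l} ≠ 0}) :
    ∃ C : ℝ, 0 < C ∧ ∀ t, ‖1 - mFourier r t‖ ^ 2 ≤ C * (1 - ‖charSum ν t‖ ^ 2) := by
  have hu : ∀ t, 0 ≤ 1 - ‖charSum ν t‖ ^ 2 := fun t => by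
    linarith [normSq_charSum_le_one ν t]
  induction hr using AddSubgroup.closure_induction with
  | mem r h =>
    obtain ⟨l, hl, l', hl', rfl⟩ := h
    have p1 : 0 < ν.real {l} := ENNReal.toReal_pos hl (measure_ne_top _ _)
    have p2 : 0 < ν.real {l'} := ENNReal.toReal_pos hl' (measure_ne_top _ _)
    have p := mul_pos p1 p2
    refine ⟨2 / (ν.real {l} * ν.real {l'}), by positivity, fun t => ?_⟩
    rw [norm_one_sub_sq_of_norm_eq_one (norm_mFourier_apply _ t), div_mul_eq_mul_div,
      le_div_iff₀ p, mul_assoc]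
    refine mul_le_mul_of_nonneg_left ?_ zero_le_two
    rw [one_sub_normSq_charSum]
    have h := setIntegral_le_integral (μ := ν.prod ν) (s := {(l, l')})
      ((integrable_const 1).sub (integrable_re_mFourier_sub ν t))
      (ae_of_all _ fun z => sub_nonneg.2 ((Complex.re_le_norm _).trans
        (norm_mFourier_apply _ t).le))
    refine le_trans (le_of_eq ?_) h
    rw [integral_singleton, ← Set.singleton_prod_singleton, measureReal_prod_prod]
    simp [mul_comm]
  | zero => exact ⟨1, one_pos, fun t => by simpa [mFourier_zero] using hu t⟩
  | add x y _ _ hx hy =>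
    obtain ⟨C, hC, hx⟩ := hx
    obtain ⟨C', hC', hy⟩ := hy
    refine ⟨2 * C + 2 * C', by positivity, fun t => ?_⟩
    have h1 : ‖1 - mFourier (x + y) t‖ ≤ ‖1 - mFourier x t‖ + ‖1 - mFourier y t‖ := by
      have : 1 - mFourier (x + y) t =
          (1 - mFourier x t) + mFourier x t * (1 - mFourier y t) := by
        rw [mFourier_add]; ring
      rw [this]
      refine (norm_add_le _ _).trans ?_
      rw [norm_mul, norm_mFourier_apply, one_mul]
    have h2 : ‖1 - mFourier (x + y) t‖ ^ 2 ≤ (‖1 - mFourier x t‖ + ‖1 - mFourier y t‖) ^ 2 :=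
      pow_le_pow_left₀ (norm_nonneg _) h1 2
    nlinarith [hx t, hy t, sq_nonneg (‖1 - mFourier x t‖ - ‖1 - mFourier y t‖)]
  | neg x _ hx =>
    obtain ⟨C, hC, hx⟩ := hx
    refine ⟨C, hC, fun t => ?_⟩
    rw [mFourier_neg, ← map_one (starRingEnd ℂ), ← map_sub, Complex.norm_conj]
    exact hx t

end charSum

section walk

variable {d : ℕ} {Ω : Type*} [MeasurableSpace Ω] {P : Measure Ω}
  {X : ℕ → Ω → (Fin d → ℤ)}

theorem measurable_walk (hmeas : ∀ k, Measurable (X k)) (n : ℕ) : Measurable (walk X n) := by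
  unfold walk
  exact Finset.measurable_fun_sum _ fun k _ => hmeas k

theorem baryc_eq_map (hmeas : ∀ k, Measurable (X k)) (n : ℕ) (l : Fin d → ℤ) :
    baryc P X n l = (P.map (walk X n)).real {l} := by
  rw [map_measureReal_apply (measurable_walk hmeas n) (measurableSet_singleton l)]
  rfl

theorem lawSupport_eq {Y : Ω → (Fin d → ℤ)} (hY : Measurable Y) :
    lawSupport P Y = {l | P.map Y {l} ≠ 0} := by
  ext l
  simp only [lawSupport, Set.mem_ofPred_eq, Measure.map_apply hY (measurableSet_singleton l)]
  rfl

theorem charSum_map {Y : Ω → (Fin d → ℤ)} (hY : Measurable Y) (t : UnitAddTorus (Fin d)) :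
    charSum (P.map Y) t = ∫ ω, mFourier (Y ω) t ∂P :=
  integral_map hY.aemeasurable (measurable_of_countable _).aestronglyMeasurable

theorem mFourier_sum {ι : Type*} (s : Finset ι) (f : ι → Fin d → ℤ) (t : UnitAddTorus (Fin d)) :
    mFourier (∑ k ∈ s, f k) t = ∏ k ∈ s, mFourier (f k) t := by
  classical
  induction s using Finset.induction_on with
  | empty => simp [mFourier_zero]
  | insert a s ha ih => rw [Finset.sum_insert ha, Finset.prod_insert ha, mFourier_add, ih]

theorem charSum_map_walk (hmeas : ∀ k, Measurable (X k)) (hindep : iIndepFun X P)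
    (hident : ∀ k, IdentDistrib (X k) (X 0) P P) (n : ℕ) (t : UnitAddTorus (Fin d)) :
    charSum (P.map (walk X n)) t = charSum (P.map (X 0)) t ^ n := by
  have hi : iIndepFun (fun (k : Fin n) => X k) P := hindep.precomp Fin.val_injective
  rw [charSum_map (measurable_walk hmeas n)]
  have h := iIndepFun.integral_fun_prod_comp (f := fun _ x => mFourier x t) hi
    (fun k => (hmeas k).aemeasurable) (fun k => (measurable_of_countable _).aestronglyMeasurable)
  simp only [walk, mFourier_sum]
  simp only [Finset.prod_range]
  rw [h]
  have h2 : ∀ k, ∫ ω, mFourier (X k ω) t ∂P = charSum (P.map (X 0)) t := fun k => by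
    rw [← charSum_map (hmeas k), (hident k).map_eq]
  simp [h2]

variable [IsProbabilityMeasure P]

theorem hasSum_sq_baryc (hmeas : ∀ k, Measurable (X k)) (hindep : iIndepFun X P)
    (hident : ∀ k, IdentDistrib (X k) (X 0) P P) (n : ℕ) :
    HasSum (fun l => baryc P X n l ^ 2)
      (∫ t, (‖charSum (P.map (X 0)) t‖ ^ 2) ^ n ∂torusMeasure d) := by
  have := Measure.isProbabilityMeasure_map (μ := P) (measurable_walk hmeas n).aemeasurable
  have h : ∀ t, (‖charSum (P.map (X 0)) t‖ ^ 2) ^ n = ‖charSum (P.map (walk X n)) t‖ ^ 2 :=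
    fun t => by
      rw [charSum_map_walk hmeas hindep hident, norm_pow]
      ring
  simp_rw [baryc_eq_map hmeas, h]
  exact hasSum_sq_charSum (P.map (walk X n))

theorem normKernel_baryc (hmeas : ∀ k, Measurable (X k)) (hindep : iIndepFun X P)
    (hident : ∀ k, IdentDistrib (X k) (X 0) P P) (n : ℕ) (t : UnitAddTorus (Fin d)) :
    normKernel (baryc P X n) t = (‖charSum (P.map (X 0)) t‖ ^ 2) ^ n /
      ∫ t, (‖charSum (P.map (X 0)) t‖ ^ 2) ^ n ∂torusMeasure d := by
  have := Measure.isProbabilityMeasure_map (μ := P) (measurable_walk hmeas n).aemeasurable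
  rw [normKernel, (hasSum_sq_baryc hmeas hindep hident n).tsum_eq]
  congr 1
  simp_rw [baryc_eq_map hmeas, ← charSum_eq_tsum, charSum_map_walk hmeas hindep hident, norm_pow]
  ring

end walk

section concentration

variable {α : Type*} [TopologicalSpace α] [CompactSpace α] [MeasurableSpace α] [BorelSpace α]
  (μ : Measure α) [IsProbabilityMeasure μ]

theorem _root_.Continuous.integrable_of_compactSpace {f : α → ℝ} (hf : Continuous f) :
    Integrable f μ := by
  obtain ⟨M, hM⟩ := isCompact_univ.exists_bound_of_continuousOn hf.continuousOn
  exact Integrable.of_bound hf.aestronglyMeasurable M (ae_of_all _ fun x => hM x (Set.mem_univ x))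

variable [μ.IsOpenPosMeasure]

/-- A constant lower bound of the order `σ ^ n`, `σ < 1`, for the integral of `u ^ n` when `u`
attains the value `1`. -/
theorem exists_mul_pow_le_integral_pow {u : α → ℝ} (hu : Continuous u) (h0 : ∀ t, 0 ≤ u t)
    {x₀ : α} (hx₀ : u x₀ = 1) {σ : ℝ} (hσ0 : 0 ≤ σ) (hσ : σ < 1) :
    ∃ m : ℝ, 0 < m ∧ ∀ n : ℕ, m * σ ^ n ≤ ∫ t, u t ^ n ∂μ := by
  have ho : IsOpen {t | σ < u t} := isOpen_lt continuous_const hu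
  have hpos : 0 < μ.real {t | σ < u t} :=
    ENNReal.toReal_pos (ho.measure_pos μ ⟨x₀, by simpa [hx₀] using hσ⟩).ne' (measure_ne_top _ _)
  refine ⟨_, hpos, fun n => ?_⟩
  have h1 := setIntegral_le_integral (μ := μ) (s := {t | σ < u t})
    ((hu.pow n).integrable_of_compactSpace μ) (ae_of_all _ fun t => pow_nonneg (h0 t) n)
  refine le_trans ?_ h1
  have h2 := setIntegral_mono_on (μ := μ) (s := {t | σ < u t}) (f := fun _ => σ ^ n)
    (integrable_const _).integrableOn
    ((hu.pow n).integrable_of_compactSpace μ).integrableOn ho.measurableSet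
    (fun t ht => pow_le_pow_left₀ hσ0 (le_of_lt ht) n)
  simpa using h2

/-- The probability measures with densities proportional to `u ^ n` concentrate on the set where
`u` attains its maximum `1`. -/
theorem tendsto_integral_mul_pow_div {u Φ : α → ℝ} (hu : Continuous u) (h0 : ∀ t, 0 ≤ u t)
    (h1 : ∀ t, u t ≤ 1) {x₀ : α} (hx₀ : u x₀ = 1) (hΦ : Continuous Φ) {c : ℝ}
    (hc : ∀ t, u t = 1 → Φ t = c) :
    Tendsto (fun n : ℕ => (∫ t, Φ t * u t ^ n ∂μ) / ∫ t, u t ^ n ∂μ) atTop (𝓝 c) := by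
  have hint : ∀ n, Integrable (fun t => u t ^ n) μ := fun n =>
    (hu.pow n).integrable_of_compactSpace μ
  have hIpos : ∀ n : ℕ, 0 < ∫ t, u t ^ n ∂μ := fun n => by
    obtain ⟨m, hm, h⟩ := exists_mul_pow_le_integral_pow μ hu h0 hx₀ (σ := 1 / 2) (by norm_num)
      (by norm_num)
    exact lt_of_lt_of_le (by positivity) (h n)
  have hcont : Continuous fun t => |Φ t - c| := (hΦ.sub continuous_const).abs
  obtain ⟨M, hM⟩ := isCompact_univ.exists_bound_of_continuousOn hcont.continuousOn
  simp only [Set.mem_univ, Real.norm_eq_abs, abs_abs, forall_const] at hM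
  have hM0 : 0 ≤ M := (abs_nonneg _).trans (hM x₀)
  rw [Metric.tendsto_atTop']
  intro ε hε
  have hρ : ∃ ρ : ℝ, 0 < ρ ∧ ρ < 1 ∧ ∀ t, ε / 4 ≤ |Φ t - c| → u t ≤ ρ := by
    have hK : IsCompact {t | ε / 4 ≤ |Φ t - c|} :=
      (isClosed_le continuous_const hcont).isCompact
    rcases Set.eq_empty_or_nonempty {t | ε / 4 ≤ |Φ t - c|} with he | hne
    · refine ⟨1 / 2, by norm_num, by norm_num, fun t ht => ?_⟩
      have : t ∈ {t | ε / 4 ≤ |Φ t - c|} := ht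
      simp [he] at this
    · obtain ⟨k, hk, hmax⟩ := hK.exists_isMaxOn hne hu.continuousOn
      refine ⟨max (u k) (1 / 2), by positivity, max_lt ?_ (by norm_num),
        fun t ht => (hmax ht).trans (le_max_left _ _)⟩
      refine lt_of_le_of_ne (h1 k) fun h => ?_
      have hk' : ε / 4 ≤ |Φ k - c| := hk
      rw [hc k h, sub_self, abs_zero] at hk'
      linarith
  obtain ⟨ρ, hρ0, hρ1, hρ⟩ := hρ
  obtain ⟨m, hm, hmle⟩ := exists_mul_pow_le_integral_pow μ hu h0 hx₀ (σ := (1 + ρ) / 2)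
    (by positivity) (by linarith)
  have hlim : Tendsto (fun n : ℕ => M / m * (ρ / ((1 + ρ) / 2)) ^ n) atTop (𝓝 (M / m * 0)) :=
    (tendsto_pow_atTop_nhds_zero_of_lt_one (by positivity)
      ((div_lt_one (by positivity)).2 (by linarith))).const_mul _
  rw [mul_zero] at hlim
  obtain ⟨N, hN⟩ := eventually_atTop.1 (hlim.eventually (gt_mem_nhds (show 0 < ε / 4 by positivity)))
  refine ⟨N, fun n hn => ?_⟩
  have hn := hN n hn.le
  have hσn : 0 < ((1 + ρ) / 2) ^ n := by positivity
  have htail : M * ρ ^ n ≤ ε / 4 * ∫ t, u t ^ n ∂μ := by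
    rw [div_pow, div_mul_div_comm, div_lt_iff₀ (by positivity)] at hn
    exact hn.le.trans (mul_le_mul_of_nonneg_left (hmle n) (by positivity))
  have hpt : ∀ t, |(Φ t - c) * u t ^ n| ≤ ε / 4 * u t ^ n + M * ρ ^ n := fun t => by
    rw [abs_mul, abs_of_nonneg (pow_nonneg (h0 t) n)]
    have hp := pow_nonneg (h0 t) n
    by_cases ht : ε / 4 ≤ |Φ t - c|
    · have a := mul_le_mul (hM t) (pow_le_pow_left₀ (h0 t) (hρ t ht) n) hp hM0
      have b : 0 ≤ ε / 4 * u t ^ n := by positivity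
      linarith
    · have a := mul_le_mul_of_nonneg_right (not_le.1 ht).le hp
      have b : 0 ≤ M * ρ ^ n := by positivity
      linarith
  have hI : |∫ t, (Φ t - c) * u t ^ n ∂μ| ≤ ε / 4 * (∫ t, u t ^ n ∂μ) + M * ρ ^ n := by
    refine (norm_integral_le_of_norm_le (f := fun t => (Φ t - c) * u t ^ n)
      (g := fun t => ε / 4 * u t ^ n + M * ρ ^ n)
      (((hint n).const_mul (ε / 4)).add (integrable_const (M * ρ ^ n)))
      (ae_of_all _ hpt)).trans (le_of_eq ?_)
    rw [integral_add ((hint n).const_mul (ε / 4)) (integrable_const _), integral_const_mul]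
    simp
  have hsub : (∫ t, Φ t * u t ^ n ∂μ) / (∫ t, u t ^ n ∂μ) - c =
      (∫ t, (Φ t - c) * u t ^ n ∂μ) / ∫ t, u t ^ n ∂μ := by
    have : ∫ t, (Φ t - c) * u t ^ n ∂μ = (∫ t, Φ t * u t ^ n ∂μ) - c * ∫ t, u t ^ n ∂μ := by
      rw [← integral_const_mul, ← integral_sub (f := fun t => Φ t * u t ^ n)
        ((hΦ.mul (hu.pow n)).integrable_of_compactSpace μ) ((hint n).const_mul c)]
      refine integral_congr_ae (ae_of_all _ fun t => ?_)
      simp only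
      ring
    rw [this, sub_div, mul_div_cancel_right₀ _ (hIpos n).ne']
  rw [Real.dist_eq, hsub, abs_div, abs_of_pos (hIpos n), div_lt_iff₀ (hIpos n)]
  nlinarith [hIpos n]

end concentration

section annihilator

variable {d : ℕ}

instance isProbabilityMeasure_annihilatorHaar (D : AddSubgroup (Fin d → ℤ)) :
    IsProbabilityMeasure (annihilatorHaar D) := by
  have : IsProbabilityMeasure
      (Measure.addHaarMeasure (⊤ : TopologicalSpace.PositiveCompacts (annihilator D))) :=
    ⟨Measure.addHaarMeasure_self⟩
  exact Measure.isProbabilityMeasure_map measurable_subtype_coe.aemeasurable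

theorem integral_annihilatorHaar (D : AddSubgroup (Fin d → ℤ))
    {f : UnitAddTorus (Fin d) → ℝ} (hf : Continuous f) :
    ∫ t, f t ∂annihilatorHaar D = ∫ s : annihilator D, f s
      ∂Measure.addHaarMeasure (⊤ : TopologicalSpace.PositiveCompacts (annihilator D)) :=
  integral_map measurable_subtype_coe.aemeasurable hf.aestronglyMeasurable

/-- The Haar measure of the annihilator is invariant under translations by its elements. -/
theorem integral_annihilatorHaar_add (D : AddSubgroup (Fin d → ℤ))
    {f : UnitAddTorus (Fin d) → ℝ} (hf : Continuous f) {t : UnitAddTorus (Fin d)}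
    (ht : t ∈ annihilator D) :
    ∫ s, f (t + s) ∂annihilatorHaar D = ∫ s, f s ∂annihilatorHaar D := by
  rw [integral_annihilatorHaar D hf, integral_annihilatorHaar D (f := fun s => f (t + s))
    (by fun_prop)]
  exact integral_add_left_eq_self (μ := Measure.addHaarMeasure
    (⊤ : TopologicalSpace.PositiveCompacts (annihilator D)))
    (fun s : annihilator D => f s) ⟨t, ht⟩

theorem ae_mem_annihilator (D : AddSubgroup (Fin d → ℤ)) :
    ∀ᵐ s ∂annihilatorHaar D, s ∈ annihilator D := by
  exact (ae_map_iff measurable_subtype_coe.aemeasurable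
    (isClosed_annihilator D).measurableSet).2 (ae_of_all _ fun s => s.2)

variable (ν : Measure (Fin d → ℤ)) [IsProbabilityMeasure ν]

theorem exists_atom : ∃ l, ν {l} ≠ 0 := by
  by_contra! h
  have h' : ∀ᵐ x ∂ν, False := ae_iff_of_countable.2 fun x hx => hx (h x)
  exact h'.exists.elim fun _ hf => hf

theorem norm_charSum_add {s : UnitAddTorus (Fin d)}
    (hs : s ∈ annihilator (latticeD {l | ν {l} ≠ 0})) (t : UnitAddTorus (Fin d)) :
    ‖charSum ν (t + s)‖ = ‖charSum ν t‖ := by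
  obtain ⟨l₀, hl₀⟩ := exists_atom ν
  have h : charSum ν (t + s) = charSum ν t * mFourier l₀ s := by
    rw [charSum, charSum, ← integral_mul_const]
    refine integral_congr_ae (ae_iff_of_countable.2 fun x hx => ?_)
    have h1 := hs (x - l₀) (AddSubgroup.subset_closure ⟨x, hx, l₀, hl₀, rfl⟩)
    have h2 : mFourier x s = mFourier l₀ s := by
      rw [← sub_add_cancel x l₀, mFourier_add, h1, one_mul]
    simp only [mFourier_apply_add, h2]
  rw [h, norm_mul, norm_mFourier_apply, mul_one]

theorem mem_annihilator_of_normSq_charSum_eq_one {t : UnitAddTorus (Fin d)}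
    (ht : ‖charSum ν t‖ ^ 2 = 1) : t ∈ annihilator (latticeD {l | ν {l} ≠ 0}) := by
  intro r hr
  obtain ⟨C, _, hC⟩ := exists_norm_one_sub_mFourier_sq_le ν hr
  have h := hC t
  rw [ht, sub_self, mul_zero] at h
  have h' : ‖1 - mFourier r t‖ = 0 := by nlinarith [norm_nonneg (1 - mFourier r t)]
  exact (sub_eq_zero.1 (norm_eq_zero.1 h')).symm

/-- Weak convergence of the normalized powers of `|φ|²` to the Haar measure of the annihilator of
the lattice generated by the differences of atoms. -/
theorem tendsto_integral_normSq_charSum_pow (f : C(UnitAddTorus (Fin d), ℝ)) :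
    Tendsto (fun n : ℕ => ∫ t, (‖charSum ν t‖ ^ 2) ^ n /
      (∫ t, (‖charSum ν t‖ ^ 2) ^ n ∂torusMeasure d) * f t ∂torusMeasure d) atTop
      (𝓝 (∫ t, f t ∂annihilatorHaar (latticeD {l | ν {l} ≠ 0}))) := by
  set Γ := latticeD {l | ν {l} ≠ 0} with hΓ
  set u : UnitAddTorus (Fin d) → ℝ := fun t => ‖charSum ν t‖ ^ 2 with hu
  have huc : Continuous u := (continuous_charSum ν).norm.pow 2
  have h0 : ∀ t, 0 ≤ u t := fun t => by positivity
  have h1 : ∀ t, u t ≤ 1 := normSq_charSum_le_one ν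
  obtain ⟨M, hM⟩ := isCompact_univ.exists_bound_of_continuousOn f.continuous.continuousOn
  simp only [Set.mem_univ, forall_const] at hM
  let Φ : UnitAddTorus (Fin d) → ℝ := fun t => ∫ s, f (t + s) ∂annihilatorHaar Γ
  have hΦ : Continuous Φ := by
    refine continuous_of_dominated (bound := fun _ => M) (fun t => ?_)
      (fun t => ae_of_all _ fun s => hM _) (integrable_const _)
      (ae_of_all _ fun s => by fun_prop)
    exact Continuous.aestronglyMeasurable (by fun_prop)
  have hc : ∀ t, u t = 1 → Φ t = ∫ s, f s ∂annihilatorHaar Γ := fun t ht =>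
    integral_annihilatorHaar_add Γ f.continuous (mem_annihilator_of_normSq_charSum_eq_one ν ht)
  have hav : ∀ n, ∫ t, Φ t * u t ^ n ∂torusMeasure d = ∫ t, f t * u t ^ n ∂torusMeasure d := by
    intro n
    have e1 : ∀ t, Φ t * u t ^ n = ∫ s, f (t + s) * u t ^ n ∂annihilatorHaar Γ := fun t =>
      (integral_mul_const _ _).symm
    simp_rw [e1]
    rw [integral_integral_swap]
    · have e2 : ∀ᵐ s ∂annihilatorHaar Γ, ∫ t, f (t + s) * u t ^ n ∂torusMeasure d =
          ∫ t, f t * u t ^ n ∂torusMeasure d := by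
        filter_upwards [ae_mem_annihilator Γ] with s hs
        have e3 : ∀ t, f (t + s) * u t ^ n = f (t + s) * u (t + s) ^ n := fun t => by
          simp only [hu, norm_charSum_add ν hs t]
        simp_rw [e3]
        exact integral_add_right_eq_self (fun t => f t * u t ^ n) s
      rw [integral_congr_ae e2]
      simp
    · refine Continuous.integrable_of_compactSpace _ ?_
      fun_prop
  have key := tendsto_integral_mul_pow_div (torusMeasure d) huc h0 h1 (x₀ := 0)
    (by simp [hu, charSum_zero]) hΦ hc
  refine key.congr fun n => ?_
  rw [hav, ← integral_div]
  refine integral_congr_ae (ae_of_all _ fun t => ?_)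
  simp only [hu]
  ring

end annihilator

theorem tendsto_mul_one_sub_cos_div_sqrt (b : ℝ) :
    Tendsto (fun n : ℕ => (n : ℝ) * (1 - Real.cos (b / √n))) atTop (𝓝 (b ^ 2 / 2)) := by
  have h0 : Tendsto (fun n : ℕ => b ^ 4 * (5 / 96) / (n : ℝ)) atTop (𝓝 0) :=
    tendsto_const_div_atTop_nhds_zero_nat _
  refine tendsto_iff_norm_sub_tendsto_zero.2 (squeeze_zero' (Eventually.of_forall fun _ =>
    norm_nonneg _) ?_ h0)
  filter_upwards [eventually_ge_atTop 1, eventually_ge_atTop ⌈b ^ 2⌉₊] with n hn1 hn2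
  have hn : (0 : ℝ) < n := by exact_mod_cast hn1
  have hb : b ^ 2 ≤ n := Nat.ceil_le.1 hn2
  have hs : √(n : ℝ) ^ 2 = n := Real.sq_sqrt hn.le
  have hy2 : (b / √n) ^ 2 = b ^ 2 / n := by rw [div_pow, hs]
  have hy : |b / √n| ≤ 1 := by
    rw [← sq_le_one_iff_abs_le_one, hy2]
    exact (div_le_one hn).2 hb
  have h4 : |b / √n| ^ 4 = b ^ 4 / n ^ 2 := by
    rw [show |b / √n| ^ 4 = (|b / √n| ^ 2) ^ 2 by ring, sq_abs, hy2, div_pow]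
    ring
  have hc := Real.cos_bound hy
  rw [h4, hy2] at hc
  have e : (n : ℝ) * (1 - Real.cos (b / √n)) - b ^ 2 / 2 =
      -(n * (Real.cos (b / √n) - (1 - b ^ 2 / n / 2))) := by
    field_simp
    ring
  rw [e, norm_neg, norm_mul, Real.norm_of_nonneg hn.le, Real.norm_eq_abs]
  refine (mul_le_mul_of_nonneg_left hc hn.le).trans (le_of_eq ?_)
  field_simp

/-- The pairing of an integer vector with a real vector. -/
def pairing {m : ℕ} (r : Fin m → ℤ) (x : Fin m → ℝ) : ℝ := ∑ i, (r i : ℝ) * x i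

theorem pairing_smul {m : ℕ} (r : Fin m → ℤ) (a : ℝ) (x : Fin m → ℝ) :
    pairing r (a • x) = a * pairing r x := by
  simp only [pairing, Pi.smul_apply, smul_eq_mul, Finset.mul_sum]
  exact Finset.sum_congr rfl fun i _ => by ring

/-- The projection of `ℝ^m` onto the torus. -/
def toTorus {m : ℕ} (x : Fin m → ℝ) : UnitAddTorus (Fin m) := fun i => (x i : UnitAddCircle)

theorem continuous_toTorus {m : ℕ} : Continuous (toTorus (m := m)) :=
  continuous_pi fun i => (AddCircle.continuous_mk' 1).comp (continuous_apply i)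

theorem re_mFourier_toTorus {m : ℕ} (r : Fin m → ℤ) (x : Fin m → ℝ) :
    (mFourier r (toTorus x)).re = Real.cos (2 * Real.pi * pairing r x) := by
  have h : mFourier r (toTorus x) =
      Complex.exp (((2 * Real.pi * pairing r x : ℝ) : ℂ) * Complex.I) := by
    simp only [mFourier, ContinuousMap.coe_mk, toTorus, fourier_coe_apply]
    rw [← Complex.exp_sum]
    congr 1
    push_cast [pairing]
    rw [Finset.mul_sum, Finset.sum_mul]
    exact Finset.sum_congr rfl fun i _ => by ring
  rw [h, Complex.exp_ofReal_mul_I_re]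

section laplace

variable {m : ℕ} (ν : Measure (Fin m → ℤ))

/-- The function `|φ|²` on `ℝ^m`, where `φ` is the characteristic function of `ν`. -/
def normSqChar (x : Fin m → ℝ) : ℝ := ‖charSum ν (toTorus x)‖ ^ 2

/-- Half the variance of the symmetrization of `ν`, as a quadratic form. -/
def symmForm (x : Fin m → ℝ) : ℝ :=
  ∫ z : (Fin m → ℤ) × (Fin m → ℤ), (2 * Real.pi * pairing (z.1 - z.2) x) ^ 2 / 2 ∂(ν.prod ν)

/-- The fundamental domain of `ℤ^m` in `ℝ^m` centered at the origin. -/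
def centeredCube (m : ℕ) : Set (Fin m → ℝ) := {x | ∀ i, x i ∈ Set.Ioc (-(1 / 2) : ℝ) (-(1 / 2) + 1)}

theorem measurableSet_centeredCube : MeasurableSet (centeredCube m) :=
  MeasurableSet.univ_pi' fun _ => measurableSet_Ioc

theorem abs_le_of_mem_centeredCube {x : Fin m → ℝ} (hx : x ∈ centeredCube m) (i : Fin m) :
    |x i| ≤ 1 / 2 :=
  abs_le.2 ⟨(hx i).1.le, (hx i).2.trans (by norm_num)⟩

theorem eventually_inv_sqrt_smul_mem_centeredCube (x : Fin m → ℝ) :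
    ∀ᶠ n : ℕ in atTop, (√(n : ℝ))⁻¹ • x ∈ centeredCube m := by
  refine eventually_all.2 fun i => ?_
  have h : Tendsto (fun n : ℕ => (√(n : ℝ))⁻¹ * x i) atTop (𝓝 (0 * x i)) :=
    (tendsto_inv_atTop_zero.comp
      (Real.tendsto_sqrt_atTop.comp tendsto_natCast_atTop_atTop)).mul_const _
  rw [zero_mul] at h
  exact h.eventually (Ioc_mem_nhds (by norm_num) (by norm_num))

theorem integral_torus_eq_integral_centeredCube (n : ℕ) :
    ∫ t, (‖charSum ν t‖ ^ 2) ^ n ∂torusMeasure m =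
      ∫ x, (centeredCube m).indicator (fun x => normSqChar ν x ^ n) x := by
  rw [integral_indicator measurableSet_centeredCube]
  exact integral_preimage (fun t => (‖charSum ν t‖ ^ 2) ^ n) (fun _ => -(1 / 2))

variable [IsProbabilityMeasure ν]

theorem continuous_normSqChar : Continuous (normSqChar ν) :=
  ((continuous_charSum ν).comp continuous_toTorus).norm.pow 2

theorem one_sub_normSqChar (x : Fin m → ℝ) : 1 - normSqChar ν x =
    ∫ z : (Fin m → ℤ) × (Fin m → ℤ), (1 - Real.cos (2 * Real.pi * pairing (z.1 - z.2) x))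
      ∂(ν.prod ν) := by
  rw [normSqChar, one_sub_normSq_charSum]
  simp_rw [re_mFourier_toTorus]

theorem integrable_sq_pairing_sub
    (hν : Integrable (fun x : Fin m → ℤ => ∑ i, (x i : ℝ) ^ 2) ν) (x : Fin m → ℝ) :
    Integrable (fun z : (Fin m → ℤ) × (Fin m → ℤ) =>
      (2 * Real.pi * pairing (z.1 - z.2) x) ^ 2 / 2) (ν.prod ν) := by
  have hI := ((hν.comp_fst ν).add (hν.comp_snd ν)).const_mul
    ((2 * Real.pi) ^ 2 * ∑ i, x i ^ 2)
  refine hI.mono' (measurable_of_countable _).aestronglyMeasurable (ae_of_all _ fun z => ?_)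
  rw [Real.norm_of_nonneg (by positivity)]
  have h1 : pairing (z.1 - z.2) x ^ 2 ≤
      (∑ i, (((z.1 - z.2) i : ℤ) : ℝ) ^ 2) * ∑ i, x i ^ 2 :=
    Finset.sum_mul_sq_le_sq_mul_sq _ _ _
  have h2 : (∑ i, (((z.1 - z.2) i : ℤ) : ℝ) ^ 2) ≤
      2 * (∑ i, (z.1 i : ℝ) ^ 2 + ∑ i, (z.2 i : ℝ) ^ 2) := by
    rw [← Finset.sum_add_distrib, Finset.mul_sum]
    refine Finset.sum_le_sum fun i _ => ?_
    push_cast [Pi.sub_apply]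
    nlinarith [sq_nonneg ((z.1 i : ℝ) + z.2 i)]
  have h3 : 0 ≤ ∑ i, x i ^ 2 := Finset.sum_nonneg fun i _ => sq_nonneg _
  have h4 := h1.trans (mul_le_mul_of_nonneg_right h2 h3)
  have h5 : (0 : ℝ) ≤ (2 * Real.pi) ^ 2 / 2 := by positivity
  have h6 := mul_le_mul_of_nonneg_left h4 h5
  simp only [Pi.add_apply]
  linarith

theorem tendsto_mul_one_sub_normSqChar
    (hν : Integrable (fun x : Fin m → ℤ => ∑ i, (x i : ℝ) ^ 2) ν) (x : Fin m → ℝ) :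
    Tendsto (fun n : ℕ => (n : ℝ) * (1 - normSqChar ν ((√n)⁻¹ • x))) atTop
      (𝓝 (symmForm ν x)) := by
  simp_rw [one_sub_normSqChar, ← integral_const_mul]
  refine tendsto_integral_of_dominated_convergence _
    (fun n => (measurable_of_countable _).aestronglyMeasurable)
    (integrable_sq_pairing_sub ν hν x) (fun n => ae_of_all _ fun z => ?_)
    (ae_of_all _ fun z => ?_)
  · rw [Real.norm_of_nonneg (mul_nonneg n.cast_nonneg (sub_nonneg.2 (Real.cos_le_one _))),
      pairing_smul]
    rcases Nat.eq_zero_or_pos n with rfl | hn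
    · simp only [Nat.cast_zero, zero_mul]
      positivity
    · have hn' : (0 : ℝ) < n := by exact_mod_cast hn
      have h := Real.one_sub_sq_div_two_le_cos
        (x := 2 * Real.pi * ((√(n : ℝ))⁻¹ * pairing (z.1 - z.2) x))
      have e : (2 * Real.pi * ((√(n : ℝ))⁻¹ * pairing (z.1 - z.2) x)) ^ 2 / 2 =
          (2 * Real.pi * pairing (z.1 - z.2) x) ^ 2 / 2 / n := by
        rw [mul_left_comm, mul_pow, inv_pow, Real.sq_sqrt hn'.le]
        field_simp
      rw [e] at h
      have h' := mul_le_mul_of_nonneg_left (sub_le_comm.1 h) hn'.le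
      rwa [mul_div_cancel₀ _ hn'.ne'] at h'
  · refine (tendsto_mul_one_sub_cos_div_sqrt (2 * Real.pi * pairing (z.1 - z.2) x)).congr
      fun n => ?_
    rw [pairing_smul]
    ring_nf

/-- Quadratic lower bound for `1 - |φ|²` on the unit cube centered at the origin. -/
theorem exists_mul_sum_sq_le_one_sub_normSqChar (hD : latticeD {l | ν {l} ≠ 0} = ⊤) :
    ∃ c : ℝ, 0 < c ∧ ∀ x : Fin m → ℝ, (∀ i, |x i| ≤ 1 / 2) →
      c * ∑ i, x i ^ 2 ≤ 1 - normSqChar ν x := by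
  have hC : ∀ i : Fin m, ∃ C : ℝ, 0 < C ∧ ∀ t,
      ‖1 - mFourier (Pi.single i 1) t‖ ^ 2 ≤ C * (1 - ‖charSum ν t‖ ^ 2) := fun i =>
    exists_norm_one_sub_mFourier_sq_le ν (by rw [hD]; trivial)
  choose C hC0 hC using hC
  have hS : 0 ≤ ∑ i, C i := Finset.sum_nonneg fun i _ => (hC0 i).le
  refine ⟨16 / (∑ i, C i + 1), by positivity, fun x hx => ?_⟩
  have hu : 0 ≤ 1 - normSqChar ν x := sub_nonneg.2 (normSq_charSum_le_one ν _)
  have h1 : ∀ i, 16 * x i ^ 2 ≤ C i * (1 - normSqChar ν x) := fun i => by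
    have h := hC i (toTorus x)
    rw [norm_one_sub_sq_of_norm_eq_one (norm_mFourier_apply _ _), re_mFourier_toTorus] at h
    have hp : pairing (Pi.single i 1) x = x i := by
      simp [pairing, Pi.single_apply, Finset.sum_ite_eq']
    rw [hp] at h
    have hpi := Real.pi_pos
    have h2 := Real.cos_le_one_sub_mul_cos_sq (x := 2 * Real.pi * x i) (by
      rw [abs_mul, abs_of_pos (by positivity)]
      nlinarith [hx i])
    refine le_trans ?_ h
    have e : 2 / Real.pi ^ 2 * (2 * Real.pi * x i) ^ 2 = 8 * x i ^ 2 := by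
      field_simp
      ring
    linarith
  have h2 := Finset.sum_le_sum fun i (_ : i ∈ Finset.univ) => h1 i
  rw [← Finset.mul_sum, ← Finset.sum_mul] at h2
  rw [div_mul_eq_mul_div, div_le_iff₀ (by positivity)]
  nlinarith

theorem integrable_exp_neg_mul_sum_sq {c : ℝ} (hc : 0 < c) :
    Integrable (fun x : Fin m → ℝ => Real.exp (-(c * ∑ i, x i ^ 2))) := by
  have h := Integrable.fintype_prod (ι := Fin m) (μ := fun _ => (volume : Measure ℝ))
    (f := fun _ y => Real.exp (-c * y ^ 2)) fun _ => integrable_exp_neg_mul_sq hc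
  refine h.congr (ae_of_all _ fun x => ?_)
  simp only
  rw [← Real.exp_sum, ← Finset.mul_sum, neg_mul]

/-- Laplace asymptotics for the powers of `|φ|²`, for a square integrable law whose atoms have
differences generating `ℤ^m`. -/
theorem exists_isEquivalent_integral_normSq_charSum_pow
    (hν : Integrable (fun x : Fin m → ℤ => ∑ i, (x i : ℝ) ^ 2) ν)
    (hD : latticeD {l | ν {l} ≠ 0} = ⊤) :
    ∃ C : ℝ, 0 < C ∧ (fun n : ℕ => ∫ t, (‖charSum ν t‖ ^ 2) ^ n ∂torusMeasure m) ~[atTop]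
      fun n : ℕ => C * (n : ℝ) ^ (-((m : ℝ) / 2)) := by
  obtain ⟨c, hc, hcu⟩ := exists_mul_sum_sq_le_one_sub_normSqChar ν hD
  let F : ℕ → (Fin m → ℝ) → ℝ := fun n =>
    (centeredCube m).indicator (fun x => normSqChar ν x ^ n)
  have hFm : ∀ n, Measurable (F n) := fun n =>
    ((continuous_normSqChar ν).pow n).measurable.indicator measurableSet_centeredCube
  have hbound : ∀ n : ℕ, 1 ≤ n → ∀ x,
      ‖F n ((√(n : ℝ))⁻¹ • x)‖ ≤ Real.exp (-(c * ∑ i, x i ^ 2)) := by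
    intro n hn x
    have hn' : (0 : ℝ) < n := by exact_mod_cast hn
    by_cases hx : (√(n : ℝ))⁻¹ • x ∈ centeredCube m
    · simp only [F, Set.indicator_of_mem hx]
      have h0 : 0 ≤ normSqChar ν ((√(n : ℝ))⁻¹ • x) := by unfold normSqChar; positivity
      rw [Real.norm_of_nonneg (pow_nonneg h0 n)]
      have h1 := hcu _ (abs_le_of_mem_centeredCube hx)
      have h2 : normSqChar ν ((√(n : ℝ))⁻¹ • x) ≤
          Real.exp (-(c * ∑ i, ((√(n : ℝ))⁻¹ • x) i ^ 2)) := by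
        have := Real.one_sub_le_exp_neg (c * ∑ i, ((√(n : ℝ))⁻¹ • x) i ^ 2)
        linarith
      refine (pow_le_pow_left₀ h0 h2 n).trans (le_of_eq ?_)
      rw [← Real.exp_nat_mul]
      congr 1
      simp only [Pi.smul_apply, smul_eq_mul, mul_pow, inv_pow, Real.sq_sqrt hn'.le]
      rw [← Finset.mul_sum]
      field_simp
    · simp only [F, Set.indicator_of_notMem hx, norm_zero]
      positivity
  have hlim : ∀ x, Tendsto (fun n : ℕ => F n ((√(n : ℝ))⁻¹ • x)) atTop
      (𝓝 (Real.exp (-symmForm ν x))) := by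
    intro x
    have h := Real.tendsto_one_add_pow_exp_of_tendsto
      (g := fun n : ℕ => -(1 - normSqChar ν ((√(n : ℝ))⁻¹ • x)))
      (by simpa only [mul_neg] using (tendsto_mul_one_sub_normSqChar ν hν x).neg)
    refine h.congr' ?_
    filter_upwards [eventually_inv_sqrt_smul_mem_centeredCube x] with n hn
    simp only [F, Set.indicator_of_mem hn]
    ring
  have hint : Integrable (fun x => Real.exp (-symmForm ν x)) := by
    refine (integrable_exp_neg_mul_sum_sq hc).mono' ?_ (ae_of_all _ fun x => ?_)
    · exact aestronglyMeasurable_of_tendsto_ae atTop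
        (fun n => ((hFm n).comp (measurable_const_smul _)).aestronglyMeasurable)
        (ae_of_all _ hlim)
    · refine le_of_tendsto (hlim x).norm ?_
      filter_upwards [eventually_ge_atTop 1] with n hn using hbound n hn x
  have hconv : Tendsto (fun n : ℕ => ∫ x, F n ((√(n : ℝ))⁻¹ • x)) atTop
      (𝓝 (∫ x, Real.exp (-symmForm ν x))) := by
    refine tendsto_integral_filter_of_dominated_convergence _
      (Eventually.of_forall fun n =>
        ((hFm n).comp (measurable_const_smul _)).aestronglyMeasurable) ?_
      (integrable_exp_neg_mul_sum_sq hc) (ae_of_all _ hlim)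
    filter_upwards [eventually_ge_atTop 1] with n hn using ae_of_all _ (hbound n hn)
  have hCpos : 0 < ∫ x, Real.exp (-symmForm ν x) := integral_exp_pos hint
  refine ⟨_, hCpos, ?_⟩
  refine (((isEquivalent_const_iff_tendsto hCpos.ne').2 hconv).mul
    (IsEquivalent.refl (u := fun n : ℕ => (n : ℝ) ^ (-((m : ℝ) / 2))))).congr_left ?_
  filter_upwards [eventually_ge_atTop 1] with n hn
  have hn' : (0 : ℝ) < n := by exact_mod_cast hn
  simp only [Pi.mul_apply]
  rw [integral_torus_eq_integral_centeredCube, Measure.integral_comp_smul, Module.finrank_fin_fun,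
    inv_pow, inv_inv, abs_of_nonneg (by positivity), smul_eq_mul, mul_right_comm]
  have e : √(n : ℝ) ^ m * (n : ℝ) ^ (-((m : ℝ) / 2)) = 1 := by
    rw [Real.sqrt_eq_rpow, ← Real.rpow_natCast, ← Real.rpow_mul hn'.le, ← Real.rpow_add hn']
    rw [show 1 / 2 * (m : ℝ) + -((m : ℝ) / 2) = 0 by ring, Real.rpow_zero]
  rw [e, one_mul]

end laplace

section lattice

variable {d : ℕ}

/-- The inclusion of `ℤ^d` in `ℝ^d`. -/
def toRealVec (d : ℕ) : (Fin d → ℤ) →+ (Fin d → ℝ) where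
  toFun l i := l i
  map_zero' := by ext; simp
  map_add' x y := by ext; simp

theorem toRealVec_apply (l : Fin d → ℤ) (i : Fin d) : toRealVec d l i = l i := rfl

theorem latticeDim_eq (D : AddSubgroup (Fin d → ℤ)) : latticeDim D =
    Module.finrank ℝ (Submodule.span ℝ (toRealVec d '' (D : Set (Fin d → ℤ)))) := rfl

/-- The real extension of an integral linear form. -/
theorem exists_real_extension (φ : (Fin d → ℤ) →ₗ[ℤ] ℤ) :
    ∃ ψ : (Fin d → ℝ) →ₗ[ℝ] ℝ, ∀ l, ψ (toRealVec d l) = φ l := by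
  refine ⟨∑ i, (φ (Pi.single i 1) : ℝ) • LinearMap.proj i, fun l => ?_⟩
  rw [LinearMap.pi_apply_eq_sum_univ φ l]
  simp only [LinearMap.sum_apply, LinearMap.smul_apply, LinearMap.proj_apply, smul_eq_mul,
    toRealVec_apply, Int.cast_sum, Int.cast_mul]
  refine Finset.sum_congr rfl fun i _ => ?_
  rw [mul_comm]
  congr 3
  ext j
  simp [Pi.single_apply, eq_comm]

theorem sq_linearForm_le (φ : (Fin d → ℤ) →ₗ[ℤ] ℤ) :
    ∃ K : ℝ, 0 ≤ K ∧ ∀ l, (φ l : ℝ) ^ 2 ≤ K * ∑ i, (l i : ℝ) ^ 2 := by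
  refine ⟨∑ i, (φ (fun j => if i = j then 1 else 0) : ℝ) ^ 2,
    Finset.sum_nonneg fun i _ => sq_nonneg _, fun l => ?_⟩
  rw [LinearMap.pi_apply_eq_sum_univ φ l, mul_comm]
  push_cast [smul_eq_mul]
  exact Finset.sum_mul_sq_le_sq_mul_sq _ _ _

theorem latticeDim_eq_of_basis {D : AddSubgroup (Fin d → ℤ)} {m : ℕ}
    (s : Module.Basis.SmithNormalForm (AddSubgroup.toIntSubmodule D) (Fin d) m) :
    latticeDim D = m := by
  have ha : ∀ i, s.a i ≠ 0 := fun i h => by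
    have h1 := s.snf i
    rw [h, zero_smul] at h1
    exact s.bN.ne_zero i (Subtype.ext h1)
  have hli : LinearIndependent ℝ fun i => toRealVec d (s.bN i : Fin d → ℤ) := by
    rw [Fintype.linearIndependent_iff]
    intro g hg j
    obtain ⟨ψ, hψ⟩ := exists_real_extension (s.bM.coord (s.f j))
    have h := congrArg ψ hg
    simp only [map_sum, map_smul, hψ, s.snf, map_zero, Module.Basis.coord_apply,
      Module.Basis.repr_self, smul_eq_mul, Finsupp.single_apply, EmbeddingLike.apply_eq_iff_eq,
      mul_ite, mul_one, mul_zero, Int.cast_ite, Int.cast_zero, Finset.sum_ite_eq',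
      Finset.mem_univ, if_true] at h
    exact (mul_eq_zero.1 h).resolve_right (Int.cast_ne_zero.2 (ha j))
  have hspan : Submodule.span ℝ (toRealVec d '' (D : Set (Fin d → ℤ))) =
      Submodule.span ℝ (Set.range fun i => toRealVec d (s.bN i : Fin d → ℤ)) := by
    refine le_antisymm (Submodule.span_le.2 ?_) (Submodule.span_mono ?_)
    · rintro _ ⟨r, hr, rfl⟩
      have h := congrArg (fun z : AddSubgroup.toIntSubmodule D => toRealVec d z)
        (s.bN.sum_repr ⟨r, hr⟩)
      simp only [Submodule.coe_sum, Submodule.coe_smul, map_sum, map_zsmul] at h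
      rw [← h]
      refine Submodule.sum_mem _ fun i _ => ?_
      rw [← Int.cast_smul_eq_zsmul ℝ]
      exact Submodule.smul_mem _ _ (Submodule.subset_span ⟨i, rfl⟩)
    · rintro _ ⟨i, rfl⟩
      exact ⟨_, (s.bN i).2, rfl⟩
  rw [latticeDim_eq, hspan, finrank_span_eq_card hli, Fintype.card_fin]

/-- Affine coordinates on a coset of the lattice generated by the differences. -/
theorem exists_latticeD_coordinates {S : Set (Fin d → ℤ)} {l₀ : Fin d → ℤ} (hl₀ : l₀ ∈ S) :
    ∃ (m : ℕ) (B : (Fin m → ℤ) →+ (Fin d → ℤ)) (g : (Fin d → ℤ) → (Fin m → ℤ)) (K : ℝ),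
      latticeDim (latticeD S) = m ∧ Function.Injective B ∧ (∀ w, B w ∈ latticeD S) ∧
      (∀ x ∈ S, x = l₀ + B (g x)) ∧
      ∀ x, ∑ j, (g x j : ℝ) ^ 2 ≤ K * (1 + ∑ i, (x i : ℝ) ^ 2) := by
  obtain ⟨m, s⟩ := Submodule.smithNormalForm (Pi.basisFun ℤ (Fin d))
    (AddSubgroup.toIntSubmodule (latticeD S))
  have ha : ∀ i, s.a i ≠ 0 := fun i h => by
    have h1 := s.snf i
    rw [h, zero_smul] at h1
    exact s.bN.ne_zero i (Subtype.ext h1)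
  choose k hk0 hk using fun j => sq_linearForm_le (s.bM.coord (s.f j))
  refine ⟨m, ((AddSubgroup.toIntSubmodule (latticeD S)).subtype ∘ₗ
    s.bN.equivFun.symm.toLinearMap).toAddMonoidHom,
    fun x j => s.bM.coord (s.f j) (x - l₀) / s.a j,
    (∑ j, k j) * (2 * (1 + ∑ i, (l₀ i : ℝ) ^ 2)), latticeDim_eq_of_basis s,
    Subtype.val_injective.comp s.bN.equivFun.symm.injective,
    fun w => (s.bN.equivFun.symm w).2, fun x hx => ?_, fun x => ?_⟩
  · have hmem : x - l₀ ∈ AddSubgroup.toIntSubmodule (latticeD S) :=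
      AddSubgroup.subset_closure ⟨x, hx, l₀, hl₀, rfl⟩
    have h : (fun j => s.bM.coord (s.f j) (x - l₀) / s.a j) =
        s.bN.equivFun ⟨x - l₀, hmem⟩ := by
      ext j
      have h1 := s.repr_apply_embedding_eq_repr_smul (i := j) ⟨x - l₀, hmem⟩
      simp only [map_smul, Finsupp.smul_apply, smul_eq_mul] at h1
      rw [Module.Basis.coord_apply, h1, Int.mul_ediv_cancel_left _ (ha j)]
      rfl
    change x = l₀ + ((s.bN.equivFun.symm (fun j => s.bM.coord (s.f j) (x - l₀) / s.a j) :
      AddSubgroup.toIntSubmodule (latticeD S)) : Fin d → ℤ)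
    rw [h, LinearEquiv.symm_apply_apply]
    simp
  · rw [Finset.sum_mul, Finset.sum_mul]
    refine Finset.sum_le_sum fun j _ => ?_
    have h1 : ((s.bM.coord (s.f j) (x - l₀) / s.a j : ℤ) : ℝ) ^ 2 ≤
        (s.bM.coord (s.f j) (x - l₀) : ℝ) ^ 2 := by
      have : (s.bM.coord (s.f j) (x - l₀) / s.a j : ℤ) ^ 2 ≤
          (s.bM.coord (s.f j) (x - l₀)) ^ 2 := sq_le_sq.2 (Int.abs_ediv_le_abs _ _)
      exact_mod_cast this
    have h2 : ∑ i, (((x - l₀) i : ℤ) : ℝ) ^ 2 ≤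
        2 * (∑ i, (x i : ℝ) ^ 2 + ∑ i, (l₀ i : ℝ) ^ 2) := by
      rw [← Finset.sum_add_distrib, Finset.mul_sum]
      refine Finset.sum_le_sum fun i _ => ?_
      push_cast [Pi.sub_apply]
      nlinarith [sq_nonneg ((x i : ℝ) + l₀ i)]
    have h3 : 0 ≤ ∑ i, (x i : ℝ) ^ 2 := Finset.sum_nonneg fun i _ => sq_nonneg _
    have h4 : 0 ≤ ∑ i, (l₀ i : ℝ) ^ 2 := Finset.sum_nonneg fun i _ => sq_nonneg _
    refine (h1.trans (hk j _)).trans ?_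
    rw [mul_assoc]
    refine mul_le_mul_of_nonneg_left (h2.trans ?_) (hk0 j)
    nlinarith [mul_nonneg h3 h4]

/-- The dimension of the lattice of differences of a generating set of a finite index subgroup. -/
theorem exists_latticeDim_add_eq {S : Set (Fin d → ℤ)} {l₀ : Fin d → ℤ} (hl₀ : l₀ ∈ S)
    (hL : (latticeL S).FiniteIndex) :
    ∃ δ : ℕ, (δ = 0 ∨ δ = 1) ∧ latticeDim (latticeD S) + δ = d := by
  set W := Submodule.span ℝ (toRealVec d '' (latticeD S : Set (Fin d → ℤ))) with hW
  set V := Submodule.span ℝ {toRealVec d l₀} with hV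
  have hLW : ∀ v ∈ latticeL S, toRealVec d v ∈ W ⊔ V := fun v hv => by
    induction hv using AddSubgroup.closure_induction with
    | mem x hx =>
      rw [← sub_add_cancel x l₀, map_add]
      exact Submodule.add_mem_sup
        (Submodule.subset_span ⟨x - l₀, AddSubgroup.subset_closure ⟨x, hx, l₀, hl₀, rfl⟩, rfl⟩)
        (Submodule.mem_span_singleton_self _)
    | zero => rw [map_zero]; exact Submodule.zero_mem _
    | add x y _ _ hx hy => rw [map_add]; exact Submodule.add_mem _ hx hy
    | neg x _ hx => rw [map_neg]; exact Submodule.neg_mem _ hx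
  have htop : W ⊔ V = ⊤ := by
    rw [eq_top_iff, ← (Pi.basisFun ℝ (Fin d)).span_eq, Submodule.span_le]
    rintro _ ⟨i, rfl⟩
    have h1 := hLW _ ((latticeL S).nsmul_index_mem (Pi.single i 1))
    have h2 : ((latticeL S).index : ℝ) ≠ 0 := Nat.cast_ne_zero.2 hL.index_ne_zero
    rw [map_nsmul, ← Nat.cast_smul_eq_nsmul ℝ, Submodule.smul_mem_iff _ h2] at h1
    have e : toRealVec d (Pi.single i 1) = Pi.basisFun ℝ (Fin d) i := by
      ext j
      simp [toRealVec_apply, Pi.single_apply]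
    rwa [e] at h1
  have h1 : d ≤ Module.finrank ℝ W + 1 := by
    have h := Submodule.finrank_add_le_finrank_add_finrank W V
    rw [htop, finrank_top, Module.finrank_fin_fun] at h
    have hV1 : Module.finrank ℝ V ≤ 1 := by
      simpa using finrank_span_le_card (R := ℝ) ({toRealVec d l₀} : Set (Fin d → ℝ))
    omega
  have h2 : Module.finrank ℝ W ≤ d := by
    simpa using Submodule.finrank_le W
  rw [latticeDim_eq, ← hW]
  exact ⟨d - Module.finrank ℝ W, by omega, by omega⟩

end lattice

section reduction

variable {d : ℕ} {Ω : Type*} [MeasurableSpace Ω] {P : Measure Ω}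
  {X : ℕ → Ω → (Fin d → ℤ)}

theorem ae_mem_lawSupport (hmeas : ∀ k, Measurable (X k))
    (hident : ∀ k, IdentDistrib (X k) (X 0) P P) :
    ∀ᵐ ω ∂P, ∀ k, X k ω ∈ lawSupport P (X 0) := by
  refine ae_all_iff.2 fun k => ?_
  have h : ∀ᵐ x ∂P.map (X k), x ∈ lawSupport P (X 0) := by
    rw [(hident k).map_eq, ae_iff_of_countable, lawSupport_eq (hmeas 0)]
    exact fun x hx => hx
  exact ae_of_ae_map (hmeas k).aemeasurable h

theorem latticeD_map_eq_top {m : ℕ} {B : (Fin m → ℤ) →+ (Fin d → ℤ)}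
    (hB : Function.Injective B) {g : (Fin d → ℤ) → (Fin m → ℤ)} {l₀ : Fin d → ℤ}
    {Y : Ω → (Fin d → ℤ)} (hY : Measurable Y) (hBD : ∀ w, B w ∈ latticeD (lawSupport P Y))
    (hg : ∀ x ∈ lawSupport P Y, x = l₀ + B (g x)) :
    latticeD {w | P.map (fun ω => g (Y ω)) {w} ≠ 0} = ⊤ := by
  have hmem : ∀ l ∈ lawSupport P Y, g l ∈ {w | P.map (fun ω => g (Y ω)) {w} ≠ 0} := by
    intro l hl
    change P.map (fun ω => g (Y ω)) {g l} ≠ 0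
    rw [Measure.map_apply (show Measurable fun ω => g (Y ω) from (measurable_of_countable g).comp hY)
      (measurableSet_singleton _)]
    refine fun h => hl (measure_mono_null (fun ω hω => ?_) h)
    have hω' : Y ω = l := hω
    simp [hω']
  have hle : latticeD (lawSupport P Y) ≤
      (latticeD {w | P.map (fun ω => g (Y ω)) {w} ≠ 0}).map B := by
    refine (AddSubgroup.closure_le _).2 ?_
    rintro _ ⟨l, hl, l', hl', rfl⟩
    refine ⟨g l - g l', AddSubgroup.subset_closure ⟨_, hmem l hl, _, hmem l' hl', rfl⟩, ?_⟩
    rw [map_sub]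
    nth_rewrite 2 [hg l hl]
    nth_rewrite 2 [hg l' hl']
    abel
  refine eq_top_iff.2 fun w _ => ?_
  obtain ⟨w', hw', h⟩ := hle (hBD w)
  rwa [← hB h]

variable [IsProbabilityMeasure P]

/-- The sum of squares of the barycenter summation is unchanged under an affine change of
coordinates. -/
theorem tsum_sq_baryc_eq {m : ℕ} {B : (Fin m → ℤ) →+ (Fin d → ℤ)} (hB : Function.Injective B)
    {g : (Fin d → ℤ) → (Fin m → ℤ)} {l₀ : Fin d → ℤ}
    (hX : ∀ᵐ ω ∂P, ∀ k, X k ω = l₀ + B (g (X k ω))) (n : ℕ) :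
    ∑' l, baryc P X n l ^ 2 = ∑' w, baryc P (fun k ω => g (X k ω)) n w ^ 2 := by
  have hwalk : ∀ᵐ ω ∂P, walk X n ω = n • l₀ + B (walk (fun k ω => g (X k ω)) n ω) := by
    filter_upwards [hX] with ω hω
    simp only [walk, map_sum]
    rw [Finset.sum_congr rfl fun k _ => hω k, Finset.sum_add_distrib]
    simp
  have hinj : Function.Injective fun w => n • l₀ + B w := fun a b h => hB (add_left_cancel h)
  have hval : ∀ w, baryc P X n (n • l₀ + B w) = baryc P (fun k ω => g (X k ω)) n w := fun w => by
    refine measureReal_congr ?_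
    filter_upwards [hwalk] with ω hω
    refine propext ?_
    change walk X n ω = n • l₀ + B w ↔ walk (fun k ω => g (X k ω)) n ω = w
    rw [hω]
    exact hinj.eq_iff
  simp_rw [← hval]
  refine (hinj.tsum_eq (f := fun l => baryc P X n l ^ 2) fun l hl => ?_).symm
  by_contra hne
  refine hl ?_
  have : baryc P X n l = 0 := by
    refine (measureReal_eq_zero_iff).2 ?_
    refine measure_mono_null (fun ω hω => ?_) (ae_iff.1 hwalk)
    have hω' : walk X n ω = l := hω
    exact fun h => hne ⟨_, h.symm.trans hω'⟩
  simp [this]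

theorem lawSupport_nonempty (hX : Measurable (X 0)) : (lawSupport P (X 0)).Nonempty := by
  have := Measure.isProbabilityMeasure_map (μ := P) hX.aemeasurable
  rw [lawSupport_eq hX]
  exact exists_atom (P.map (X 0))

/-- The order of the normalization for square integrable steps. -/
theorem exists_isEquivalent_tsum_sq_baryc (hmeas : ∀ k, Measurable (X k))
    (hindep : iIndepFun X P) (hident : ∀ k, IdentDistrib (X k) (X 0) P P)
    (hsq : Integrable (fun ω => ∑ i, (X 0 ω i : ℝ) ^ 2) P) :
    ∃ C : ℝ, 0 < C ∧ (fun n : ℕ => ∑' l, baryc P X n l ^ 2) ~[atTop]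
      fun n : ℕ => C * (n : ℝ) ^ (-((latticeDim (latticeD (lawSupport P (X 0))) : ℝ) / 2)) := by
  obtain ⟨l₀, hl₀⟩ := lawSupport_nonempty (P := P) (hmeas 0)
  obtain ⟨m, B, g, K, hm, hB, hBD, hg, hK⟩ := exists_latticeD_coordinates hl₀
  have hgm : Measurable g := measurable_of_countable g
  have hYm : ∀ k, Measurable fun ω => g (X k ω) := fun k => hgm.comp (hmeas k)
  have hX : ∀ᵐ ω ∂P, ∀ k, X k ω = l₀ + B (g (X k ω)) := by
    filter_upwards [ae_mem_lawSupport hmeas hident] with ω hω k using hg _ (hω k)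
  have hYindep : iIndepFun (fun k ω => g (X k ω)) P := hindep.comp (fun _ => g) fun _ => hgm
  have hYident : ∀ k, IdentDistrib (fun ω => g (X k ω)) (fun ω => g (X 0 ω)) P P :=
    fun k => (hident k).comp hgm
  have := Measure.isProbabilityMeasure_map (μ := P) (hYm 0).aemeasurable
  have hYsq : Integrable (fun x : Fin m → ℤ => ∑ i, (x i : ℝ) ^ 2)
      (P.map fun ω => g (X 0 ω)) := by
    rw [integrable_map_measure (measurable_of_countable _).aestronglyMeasurable
      (hYm 0).aemeasurable]
    refine (((integrable_const 1).add hsq).const_mul K).mono'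
      ((measurable_of_countable _).comp (hYm 0)).aestronglyMeasurable (ae_of_all _ fun ω => ?_)
    exact (Real.norm_of_nonneg (Finset.sum_nonneg fun i _ => sq_nonneg _)).trans_le (hK (X 0 ω))
  obtain ⟨C, hC, h⟩ := exists_isEquivalent_integral_normSq_charSum_pow
    (P.map fun ω => g (X 0 ω)) hYsq (latticeD_map_eq_top hB (hmeas 0) hBD hg)
  refine ⟨C, hC, ?_⟩
  simp_rw [hm, tsum_sq_baryc_eq hB hX, (hasSum_sq_baryc hYm hYindep hYident _).tsum_eq]
  exact h

end reduction

end BarycenterSummation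

end

theorem mainTheorem10 {d : ℕ} (hd : 1 ≤ d)
    {Ω : Type*} [MeasurableSpace Ω] (P : Measure Ω) [IsProbabilityMeasure P]
    (X : ℕ → Ω → (Fin d → ℤ))
    (hmeas : ∀ k, Measurable (X k))
    (hindep : iIndepFun X P)
    (hident : ∀ k, IdentDistrib (X k) (X 0) P P)
    (hreduced : (BarycenterSummation.latticeL
      (BarycenterSummation.lawSupport P (X 0))).FiniteIndex) :
    BarycenterSummation.IsRegular (BarycenterSummation.baryc P X)
        (BarycenterSummation.annihilatorHaar
          (BarycenterSummation.latticeD (BarycenterSummation.lawSupport P (X 0)))) ∧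
      ∃ δ : ℕ, (δ = 0 ∨ δ = 1) ∧
        BarycenterSummation.latticeDim
          (BarycenterSummation.latticeD (BarycenterSummation.lawSupport P (X 0))) + δ = d ∧
        (Integrable (fun ω => ∑ i, (X 0 ω i : ℝ) ^ 2) P →
          ∃ C : ℝ, 0 < C ∧
            (fun n : ℕ => ∑' l, BarycenterSummation.baryc P X n l ^ 2) ~[atTop]
              fun n : ℕ => C * (n : ℝ) ^
                (-((BarycenterSummation.latticeDim (BarycenterSummation.latticeD
                  (BarycenterSummation.lawSupport P (X 0))) : ℝ) / 2))) := by
  have := Measure.isProbabilityMeasure_map (μ := P) (hmeas 0).aemeasurable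
  refine ⟨⟨inferInstance, fun φ => ?_⟩, ?_⟩
  · simp_rw [BarycenterSummation.normKernel_baryc hmeas hindep hident,
      BarycenterSummation.lawSupport_eq (hmeas 0)]
    exact BarycenterSummation.tendsto_integral_normSq_charSum_pow (P.map (X 0)) φ
  · obtain ⟨l₀, hl₀⟩ := BarycenterSummation.lawSupport_nonempty (P := P) (hmeas 0)
    obtain ⟨δ, hδ, h⟩ := BarycenterSummation.exists_latticeDim_add_eq hl₀ hreduced
    exact ⟨δ, hδ, h,
      BarycenterSummation.exists_isEquivalent_tsum_sq_baryc hmeas hindep hident⟩
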